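/- **Fermions.** Let $\mathcal F$ be the space of (possibly infinite) formal sums $\sum_S c_S|S\rangle$, $c_S\in\mathbb C$, over the sets $S=\{s_1>s_2>\cdots\}\subset\mathbb Z+\frac12$ with finitely many positive elements and finitely many negative half-integers missing, $|S\rangle=\underline{s_1}\wedge\underline{s_2}\wedge\cdots$. Let $\psi_k|S\rangle=\underline k\wedge|S\rangle$, and $\psi_k^*|S\rangle=(-1)^{l+1}\,\underline{s_1}\wedge\cdots\widehat{\underline{s_l}}\cdots$ if $s_l=k$, $\psi_k^*|S\rangle=0$ if $k\notin S$. Put $|N\rangle=\underline{N-\frac12}\wedge\underline{N-\frac32}\wedge\cdots$ for $N\in\mathbb Z$, let $\langle 0|v\rangle$ be the coefficient of $|0\rangle$ in $v$, and set $\psi(z)=\sum_{k\in\mathbb Z+\frac12}z^{k-\frac12}\psi_k$, $\psi^*(z)=\sum_{k\in\mathbb Z+\frac12}z^{-k-\frac12}\psi_k^*$. **Tau-functions in the big cell.** An admissible basis is a sequence of series $\varphi_k=z^{k+\frac12}+\sum_{i\ge 1-k}a_{k,i}z^{-i+\frac12}$, $k=0,1,2,\dots$. A series $f=\sum_n f_nz^{n+\frac12}\in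 z^{\frac12}\mathbb C((z^{-1}))$ acts on $\mathcal F$ by exterior multiplication $f\wedge v:=\sum_n f_n\psi^*_{n+\frac12}v$, for which $|N\rangle=z^{N+\frac12}\wedge z^{N+\frac32}\wedge\cdots$, and $\varphi_0\wedge\varphi_1\wedge\cdots$ denotes the coefficientwise (eventually constant) limit of $\varphi_0\wedge\cdots\wedge\varphi_{N-1}\wedge|N\rangle$ as $N\to\infty$. A vector $|V\rangle\in\mathcal F$ is a fermionic tau-function of the KP hierarchy in the big cell if $|V\rangle=c\cdot\varphi_0\wedge\varphi_1\wedge\cdots$ for some $c\neq0$ and some admissible basis; any such basis is said to correspond to $|V\rangle$. Put $$\Psi(z)=\frac{\langle0|\psi^*_{\frac12}\psi(z)|V\rangle}{\langle0|V\rangle},\qquad \Psi^*(z)=\frac{\langle0|\psi_{-\frac12}\psi^*(z)|V\rangle}{\langle0|V\rangle},\qquad \Psi(u,v)=\frac{\langle0|\psi^*(u)\psi(v)|V\rangle}{\langle0|V\rangle},$$ understood as formal series (in $\Psi(u,v)$ the term $\frac1{u-v}$ is expanded in $|u|>|v|$). **Lifting operators.** Let $w_{1+\infty}$ consist of the operators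 $l_z=\sum_{d\le D}p_d(z\partial_z)\,z^d$, $D\in\mathbb Z$, with $p_d(x)=\sum_{k\ge0}c_{d,k}x^k$ entire functions, polynomial when $d\ge2$. It contains all finite linear combinations of the $z^i\partial_z^j$ ($i\in\mathbb Z$, $j\ge0$), and also the infinite combinations, of degree at most one, such as $e^{\hbar z\partial_z}z$. The adjoint is determined by $(z^i\partial_z^j)^*=(-\partial_z)^jz^i$, that is, $\big(p_d(z\partial_z)z^d\big)^*=z^d\,p_d(-\partial_zz)$. A lifting operator for $|V\rangle$ is an $l_z\in w_{1+\infty}$ such that * for some admissible basis $\{\varphi_k\}_{k\ge0}$ corresponding to $|V\rangle$ and some nonzero complex numbers $a_k$, $k\ge1$, one has $(z^{\frac12}\,l_z\,z^{-\frac12})^k\varphi_0=a_k\varphi_k$ for all $k\ge1$; and * the degree one part $\sum_{k\ge0}c_k(z\partial_z)^kz$ of $l_z$ has $c_0=1$. **Theorem.** Let $l_z$ be a lifting operator for a fermionic tau-function $|V\rangle$ of the KP hierarchy in the big cell. Then, as formal series in $u$ and $v$, $$(l_u^*-l_v)\cdot\Psi(u,v)=\Psi^*(u)\,\Psi(v).$$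 -/

import Mathlib

noncomputable section

namespace KP

open Filter

/-! ### The fermionic Fock space

Half-integers are encoded by integers throughout: the integer `k` stands for `k + 1/2`.
Thus `ψ k` and `ψs k` below are the fermions with the half-integer index `k + 1/2`. -/

/-- Admissible sets of half-integers: finitely many positive elements, and finitely many negative
half-integers missing. -/
def IsAdmissible (S : Set ℤ) : Prop :=
  {s | s ∈ S ∧ 0 ≤ s}.Finite ∧ {s | s < 0 ∧ s ∉ S}.Finite

/-- The labels of the basis vectors `|S⟩` of the Fock space. -/
abbrev Maya : Type := {S : Set ℤ // IsAdmissible S}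

theorem IsAdmissible.insert {S : Set ℤ} (h : IsAdmissible S) (k : ℤ) :
    IsAdmissible (insert k S) := by
  refine ⟨(h.1.insert k).subset ?_, h.2.subset ?_⟩
  · rintro s ⟨hs | hs, h0⟩
    · exact Or.inl hs
    · exact Or.inr ⟨hs, h0⟩
  · rintro s ⟨h0, hs⟩
    exact ⟨h0, fun h1 => hs (Or.inr h1)⟩

theorem IsAdmissible.erase {S : Set ℤ} (h : IsAdmissible S) (k : ℤ) :
    IsAdmissible (S \ {k}) := by
  refine ⟨h.1.subset ?_, (h.2.insert k).subset ?_⟩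
  · rintro s ⟨hs, h0⟩
    exact ⟨hs.1, h0⟩
  · rintro s ⟨h0, hs⟩
    by_cases hk : s = k
    · exact Or.inl hk
    · exact Or.inr ⟨h0, fun h1 => hs ⟨h1, hk⟩⟩

theorem isAdmissible_Iio (n : ℤ) : IsAdmissible (Set.Iio n) := by
  refine ⟨(Set.finite_Ico 0 n).subset ?_, (Set.finite_Ico n 0).subset ?_⟩
  · rintro s ⟨hs, h0⟩
    exact ⟨h0, hs⟩
  · rintro s ⟨h0, hs⟩
    exact ⟨not_lt.mp hs, h0⟩

/-- The Fock space of all, possibly infinite, formal sums `∑ c_S |S⟩` over admissible `S`; the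
function value at `S` is the coefficient `c_S`. -/
abbrev Fock : Type := Maya → ℂ

/-- The basis vector `|S⟩`. -/
def ket (S : Maya) : Fock := by
  classical exact fun T => if T = S then 1 else 0

/-- The vacuum of charge `n`, the basis vector of the set of all half-integers below `n`. -/
def vac (n : ℤ) : Fock := ket ⟨Set.Iio n, isAdmissible_Iio n⟩

/-- The sign of moving the basis vector with index `k` past the elements of `S` above `k`. -/
def wsign (S : Maya) (k : ℤ) : ℂ := (-1) ^ {s : ℤ | s ∈ S.1 ∧ k < s}.ncard

/-- The fermion `ψ_{k+1/2}`: on basis vectors it is the exterior multiplication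
`|S⟩ ↦ (k + 1/2) ∧ |S⟩`, extended to formal sums. -/
def ψ (k : ℤ) (v : Fock) : Fock := by
  classical exact fun T =>
    if k ∈ T.1 then wsign T k * v ⟨T.1 \ {k}, T.2.erase k⟩ else 0

/-- The fermion `ψ^*_{k+1/2}`: on basis vectors it removes `s_l = k + 1/2` from `|S⟩` with the sign
`(-1)^{l+1}`, and is zero if `k + 1/2` is not in `S`; extended to formal sums. -/
def ψs (k : ℤ) (v : Fock) : Fock := by
  classical exact fun T =>
    if k ∈ T.1 then 0 else wsign T k * v ⟨insert k T.1, T.2.insert k⟩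

/-- The pairing `⟨0|v⟩` with the vacuum. -/
def vev (v : Fock) : ℂ := v ⟨Set.Iio 0, isAdmissible_Iio 0⟩

/-! ### Semi-infinite wedge products and tau-functions

A Laurent series `f(z) = ∑ f_n z^n` in `z⁻¹` (so `f_n = 0` for large `n`) is encoded by its
coefficient function `ℤ → ℂ`. It stands for the vector `z^{1/2} f(z)` of `z^{1/2} ℂ((z⁻¹))`. -/

/-- Exterior multiplication by `z^{1/2} f(z)`, that is the operator `∑_n f_n ψ^*_{n+1/2}`. For a
Laurent series `f` in `z⁻¹` the sum is finite on each coefficient. -/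
def wedge (f : ℤ → ℂ) (v : Fock) : Fock := fun T => ∑ᶠ n : ℤ, f n * ψs n v T

/-- `φ_0 ∧ φ_1 ∧ ⋯ ∧ φ_{N-1} ∧ v`. -/
def wedgeFirst (φ : ℕ → ℤ → ℂ) : ℕ → Fock → Fock
  | 0, v => v
  | N + 1, v => wedgeFirst φ N (wedge (φ N) v)

/-- `φ_0 ∧ ⋯ ∧ φ_{N-1} ∧ z^{N+1/2} ∧ z^{N+3/2} ∧ ⋯`. The vacuum of charge `N` is
`z^{N+1/2} ∧ z^{N+3/2} ∧ ⋯`, for it is killed by `ψ^*_{n+1/2}` exactly for `n ≥ N`; in particular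
`|0⟩ = z^{1/2} ∧ z^{3/2} ∧ ⋯`. -/
def truncWedge (φ : ℕ → ℤ → ℂ) (N : ℕ) : Fock := wedgeFirst φ N (vac N)

/-- `v = φ_0 ∧ φ_1 ∧ φ_2 ∧ ⋯`: each coefficient of `v` is the eventually constant value of the
coefficient of `φ_0 ∧ ⋯ ∧ φ_{N-1} ∧ z^{N+1/2} ∧ z^{N+3/2} ∧ ⋯`. -/
def IsSemiInfiniteWedge (φ : ℕ → ℤ → ℂ) (v : Fock) : Prop :=
  ∀ S : Maya, ∀ᶠ N : ℕ in atTop, truncWedge φ N S = v S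

/-- `(z^{1/2} φ_k)_{k ≥ 0}` is an admissible basis of `|V⟩`: each `φ_k` is `z^k` plus terms of lower
degree, and `|V⟩` is a nonzero multiple of the semi-infinite wedge product of the basis. -/
structure IsAdmissibleBasis (φ : ℕ → ℤ → ℂ) (V : Fock) : Prop where
  leading : ∀ k : ℕ, φ k k = 1
  above : ∀ (k : ℕ) (n : ℤ), (k : ℤ) < n → φ k n = 0
  wedge_eq : ∃ (c : ℂ) (w : Fock), c ≠ 0 ∧ IsSemiInfiniteWedge φ w ∧ V = c • w

/-- Fermionic tau-functions of the KP hierarchy in the big cell. -/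
def IsBigCellTau (V : Fock) : Prop := ∃ φ : ℕ → ℤ → ℂ, IsAdmissibleBasis φ V

/-! ### Fermionic one-point and two-point functions, as formal series

Here `ψ(z) = ∑_n z^n ψ_{n+1/2}` and `ψ^*(z) = ∑_n z^{-n-1} ψ^*_{n+1/2}`. -/

/-- The coefficient of `z^n` in `Ψ(z) = ⟨0|ψ^*_{1/2} ψ(z)|V⟩ / ⟨0|V⟩`. -/
def onePoint (V : Fock) (n : ℤ) : ℂ := vev (ψs 0 (ψ n V)) / vev V

/-- The coefficient of `z^n` in `Ψ^*(z) = ⟨0|ψ_{-1/2} ψ^*(z)|V⟩ / ⟨0|V⟩`. -/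
def dualOnePoint (V : Fock) (n : ℤ) : ℂ := vev (ψ (-1) (ψs (-n - 1) V)) / vev V

/-- The coefficient of `u^m v^n` in `Ψ(u,v) = ⟨0|ψ^*(u) ψ(v)|V⟩ / ⟨0|V⟩`. -/
def twoPoint (V : Fock) (m n : ℤ) : ℂ := vev (ψs (-m - 1) (ψ n V)) / vev V

/-! ### Differential operators on the circle -/

/-- Operators `∑_{d ≤ D} p_d(z∂_z) z^d`, where `p_d = symbol d` is an entire function, so that
`p_d(z∂_z) = ∑_k c_{d,k} (z∂_z)^k` with an everywhere convergent series, and a polynomial for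
`d ≥ 2`. This contains the span of all `z^i ∂_z^j` (see `W.ofFinsupp`), and also the infinite sums
of such operators in degrees at most one, such as `exp(ħ z∂_z) z` or operators whose coefficients
are power series in `z⁻¹`. -/
structure W where
  symbol : ℤ → ℂ → ℂ
  entire : ∀ d, Differentiable ℂ (symbol d)
  polynomial : ∀ d, 2 ≤ d → ∃ P : Polynomial ℂ, ∀ x, symbol d x = P.eval x
  bounded : ∃ D : ℤ, ∀ d, D < d → symbol d = 0

/-- The action on Laurent series in `z⁻¹`, given by
`p_d(z∂_z) z^d : z^n ↦ p_d(n + d) z^{n+d}`. The sum is finite. -/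
def W.act (l : W) (f : ℤ → ℂ) (m : ℤ) : ℂ := ∑ᶠ n : ℤ, l.symbol (m - n) m * f n

/-- The adjoint, `(p_d(z∂_z) z^d)^* = z^d p_d(-∂_z z) = p_d(d - 1 - z∂_z) z^d`. -/
def W.adjoint (l : W) : W where
  symbol d x := l.symbol d (d - 1 - x)
  entire d := (l.entire d).comp ((differentiable_const _).sub differentiable_id)
  polynomial d hd := by
    obtain ⟨P, hP⟩ := l.polynomial d hd
    exact ⟨P.comp (Polynomial.C ((d : ℂ) - 1) - Polynomial.X), fun x => by simp [hP]⟩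
  bounded := by
    obtain ⟨D, hD⟩ := l.bounded
    exact ⟨D, fun d hd => by funext x; simp [hD d hd]⟩

/-- The finite sum `∑ a_{ij} z^i ∂_z^j`. -/
def W.ofFinsupp (a : ℤ × ℕ →₀ ℂ) : W where
  symbol d x := ∑ p ∈ a.support,
    if p.1 - p.2 = d then a p * (descPochhammer ℂ p.2).eval (x - d) else 0
  entire d := by
    refine Differentiable.fun_sum fun p _ => ?_
    split_ifs
    · exact ((Polynomial.differentiable _).fun_comp
        (differentiable_id.sub_const (d : ℂ))).const_mul _
    · exact differentiable_const _
  polynomial d _ := by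
    refine ⟨∑ p ∈ a.support, if p.1 - p.2 = d then
      Polynomial.C (a p) * (descPochhammer ℂ p.2).comp (Polynomial.X - Polynomial.C (d : ℂ))
      else 0, fun x => ?_⟩
    rw [Polynomial.eval_finsetSum]
    refine Finset.sum_congr rfl fun p _ => ?_
    split_ifs <;> simp
  bounded := by
    obtain ⟨D, hD⟩ := (a.support.image fun p : ℤ × ℕ => p.1 - p.2).bddAbove
    refine ⟨D, fun d hd => ?_⟩
    funext x
    refine Finset.sum_eq_zero fun p hp => if_neg fun h => ?_
    have h1 : p.1 - (p.2 : ℤ) ≤ D := hD (Finset.mem_coe.mpr (Finset.mem_image_of_mem _ hp))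
    omega

/-- Multiplication of a series by `z^i`. -/
def zpowMul (i : ℤ) (f : ℤ → ℂ) (m : ℤ) : ℂ := f (m - i)

/-- The derivative of a series. -/
def dz (f : ℤ → ℂ) (m : ℤ) : ℂ := (m + 1) * f (m + 1)

theorem dz_iterate (j : ℕ) (f : ℤ → ℂ) (m : ℤ) :
    dz^[j] f m = (descPochhammer ℂ j).eval ((m : ℂ) + j) * f (m + j) := by
  induction j generalizing f with
  | zero => simp
  | succ j ih =>
    rw [Function.iterate_succ_apply, ih, descPochhammer_succ_eval, dz]
    have h1 : (m : ℂ) + ((j + 1 : ℕ) : ℂ) = (m + j) + 1 := by push_cast; ring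
    have h2 : (m : ℤ) + ((j + 1 : ℕ) : ℤ) = m + j + 1 := by push_cast; ring
    have h3 : ∀ (k : ℕ) (x : ℂ), (descPochhammer ℂ k).eval (x + 1) * (x + 1 - k)
        = (x + 1) * (descPochhammer ℂ k).eval x := by
      intro k x
      rw [← descPochhammer_succ_eval, descPochhammer_succ_left]
      simp
    rw [h1, h2, h3]
    push_cast
    ring

theorem W.finsum_ofFinsupp (a : ℤ × ℕ →₀ ℂ) (f : ℤ → ℂ) (m : ℤ) (g : ℤ × ℕ → ℤ → ℂ) :
    ∑ᶠ n : ℤ, (∑ p ∈ a.support, if p.1 - p.2 = m - n then a p * g p n else 0) * f n =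
      ∑ p ∈ a.support, a p * (g p (m - p.1 + p.2) * f (m - p.1 + p.2)) := by
  have hterm : ∀ (p : ℤ × ℕ) (n : ℤ),
      (if p.1 - p.2 = m - n then a p * g p n else 0) * f n ≠ 0 → n = m - p.1 + p.2 := by
    intro p n h
    by_contra hn
    refine h ?_
    rw [if_neg (by omega), zero_mul]
  simp_rw [Finset.sum_mul]
  rw [finsum_sum_comm]
  · refine Finset.sum_congr rfl fun p _ => ?_
    rw [finsum_eq_single _ (m - p.1 + p.2)
      (fun n hn => by_contra fun h => hn (hterm p n h)), if_pos (by ring), mul_assoc]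
  · intro p _
    exact (Set.finite_singleton (m - p.1 + (p.2 : ℤ))).subset fun n hn => hterm p n hn

/-- The action of `∑ a_{ij} z^i ∂_z^j` is the expected one. -/
theorem W.act_ofFinsupp (a : ℤ × ℕ →₀ ℂ) (f : ℤ → ℂ) (m : ℤ) :
    (W.ofFinsupp a).act f m = ∑ p ∈ a.support, a p * zpowMul p.1 (dz^[p.2] f) m := by
  unfold W.act W.ofFinsupp
  rw [W.finsum_ofFinsupp a f m
    fun p n => (descPochhammer ℂ p.2).eval ((m : ℂ) - ((m - n : ℤ) : ℂ))]
  refine Finset.sum_congr rfl fun p _ => ?_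
  rw [zpowMul, dz_iterate]
  congr 3
  push_cast
  ring

/-- The adjoint of `∑ a_{ij} z^i ∂_z^j` acts as `∑ a_{ij} (-∂_z)^j z^i`. -/
theorem W.act_adjoint_ofFinsupp (a : ℤ × ℕ →₀ ℂ) (f : ℤ → ℂ) (m : ℤ) :
    (W.ofFinsupp a).adjoint.act f m =
      ∑ p ∈ a.support, a p * ((-1) ^ p.2 * dz^[p.2] (zpowMul p.1 f) m) := by
  have key : ∀ (j : ℕ) (x : ℂ), (descPochhammer ℂ j).eval (-x - 1)
      = (-1) ^ j * (descPochhammer ℂ j).eval (x + j) := by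
    intro j
    induction j with
    | zero => simp
    | succ j ih =>
      intro x
      have h4 : (descPochhammer ℂ (j + 1)).eval (x + ((j + 1 : ℕ) : ℂ))
          = (x + j + 1) * (descPochhammer ℂ j).eval (x + j) := by
        rw [descPochhammer_succ_left]
        have h5 : x + ((j + 1 : ℕ) : ℂ) - 1 = x + j := by push_cast; ring
        have h6 : x + ((j + 1 : ℕ) : ℂ) = x + j + 1 := by push_cast; ring
        rw [Polynomial.eval_mul, Polynomial.eval_comp]
        simp only [Polynomial.eval_X, Polynomial.eval_sub, Polynomial.eval_one, h5]
        rw [h6]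
      rw [h4, descPochhammer_succ_eval, ih]
      ring
  unfold W.act W.adjoint W.ofFinsupp
  rw [W.finsum_ofFinsupp a f m fun p n => (descPochhammer ℂ p.2).eval
    ((((m - n : ℤ) : ℂ) - 1 - (m : ℂ)) - ((m - n : ℤ) : ℂ))]
  refine Finset.sum_congr rfl fun p _ => ?_
  rw [dz_iterate, zpowMul, ← mul_assoc ((-1 : ℂ) ^ p.2), ← key]
  congr 3
  · push_cast
    ring
  · ring

/-! ### Lifting operators -/

/-- `l` is a lifting operator for `|V⟩`: for some admissible basis `z^{1/2} φ_k` of `|V⟩` and some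
nonzero constants `a_k` one has `l^k φ_0 = a_k φ_k` for all `k ≥ 1`, and the coefficient `c_0 = p_1(0)`
in the degree one part `p_1(z∂_z) z = ∑_k c_k (z∂_z)^k z` of `l` is one. -/
def IsLiftingOperator (l : W) (V : Fock) : Prop :=
  (∃ (φ : ℕ → ℤ → ℂ) (a : ℕ → ℂ), IsAdmissibleBasis φ V ∧
    ∀ k : ℕ, 1 ≤ k → a k ≠ 0 ∧ l.act^[k] (φ 0) = a k • φ k) ∧
  l.symbol 1 0 = 1

/-- The action of `l_u` on a formal series `∑ F_{mn} u^m v^n`. -/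
def W.actU (l : W) (F : ℤ → ℤ → ℂ) (m n : ℤ) : ℂ := l.act (fun i => F i n) m

/-- The action of `l_v` on a formal series `∑ F_{mn} u^m v^n`. -/
def W.actV (l : W) (F : ℤ → ℤ → ℂ) (m n : ℤ) : ℂ := l.act (fun j => F m j) n

end KP

end

namespace KP

open Filter

/-! ### The fermions on coefficients -/

/-! Write E_j(v) for the coefficient of u^{-j-1} in Ψ(u,v), j ≥ 0. These rows form the normalised
basis of the point of the Grassmannian defined by V: E_j is z^j plus negative powers. A Laurent
series f with f ∧ V = 0 therefore equals ∑_{j≥0} f_j E_j (`eq_finsum_twoPoint`); each φ_k is such a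
series, and the E_j lie in the span of the φ_k by triangularity.

A lifting operator maps φ_k to a multiple of φ_{k+1}. It thus preserves that span, and polynomiality
of its symbols in degrees d ≥ 2 forces those symbols to vanish (`W.symbol_eq_zero`). Hence l E_j =
∑_{k≥0} (l E_j)_k E_k. The leading term z^j of E_j contributes p_{k-j}(k) to (l E_j)_k, and summing
these against E_k gives the row of l_u^* Ψ(u,v). Since l has degree at most one, the negative part
of E_j reaches nonnegative powers only through z^{-1} ↦ p_1(0) z^0 = z^0, which adds E_j(-1) E_0,
with E_j(-1) the coefficient of z^{-1} in E_j. As E_0 = Ψ(v) and the coefficient of u^{-j-1} in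
Ψ^*(u) is -E_j(-1), this defect is the right-hand side. In the remaining rows Ψ(u,v) has no terms,
and only u^0 contributes. -/

theorem ψs_of_mem {k : ℤ} {T : Maya} (h : k ∈ T.1) (v : Fock) : ψs k v T = 0 := by
  unfold ψs
  exact if_pos h

theorem ψs_of_notMem {k : ℤ} {T : Maya} (h : k ∉ T.1) (v : Fock) :
    ψs k v T = wsign T k * v ⟨insert k T.1, T.2.insert k⟩ := by
  unfold ψs
  exact if_neg h

theorem ψ_of_mem {k : ℤ} {T : Maya} (h : k ∈ T.1) (v : Fock) :
    ψ k v T = wsign T k * v ⟨T.1 \ {k}, T.2.erase k⟩ := by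
  unfold ψ
  exact if_pos h

theorem ψ_of_notMem {k : ℤ} {T : Maya} (h : k ∉ T.1) (v : Fock) : ψ k v T = 0 := by
  unfold ψ
  exact if_neg h

theorem finite_mem_above (T : Maya) (k : ℤ) : {s : ℤ | s ∈ T.1 ∧ k < s}.Finite := by
  refine (T.2.1.union (Set.finite_Ioo k 0)).subset ?_
  rintro s ⟨hs, hk⟩
  rcases lt_or_ge s 0 with h | h
  · exact Or.inr ⟨hk, h⟩
  · exact Or.inl ⟨hs, h⟩

theorem finite_notMem_le (T : Maya) (B : ℤ) : {s : ℤ | s ∉ T.1 ∧ s ≤ B}.Finite := by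
  refine (T.2.2.union (Set.finite_Icc 0 B)).subset ?_
  rintro s ⟨hs, hB⟩
  rcases lt_or_ge s 0 with h | h
  · exact Or.inl ⟨h, hs⟩
  · exact Or.inr ⟨h, hB⟩

theorem wsign_eq_one {T : Maya} {k : ℤ} (h : ∀ s ∈ T.1, s ≤ k) : wsign T k = 1 := by
  have h0 : {s : ℤ | s ∈ T.1 ∧ k < s} = ∅ := by
    ext s
    simp only [Set.mem_ofPred_eq, Set.mem_empty_iff_false, iff_false, not_and, not_lt]
    exact h s
  rw [wsign, h0]
  simp

theorem wsign_ne_zero (T : Maya) (k : ℤ) : wsign T k ≠ 0 :=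
  pow_ne_zero _ (by norm_num)

theorem wsign_insert_of_le {T : Maya} {a b : ℤ} (h : a ≤ b) :
    wsign ⟨insert a T.1, T.2.insert a⟩ b = wsign T b := by
  have h0 : {s : ℤ | s ∈ insert a T.1 ∧ b < s} = {s : ℤ | s ∈ T.1 ∧ b < s} := by
    ext s
    simp only [Set.mem_ofPred_eq, Set.mem_insert_iff]
    constructor
    · rintro ⟨rfl | hs, hb⟩
      · omega
      · exact ⟨hs, hb⟩
    · rintro ⟨hs, hb⟩
      exact ⟨Or.inr hs, hb⟩
  unfold wsign
  rw [h0]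

theorem wsign_insert_of_lt {T : Maya} {a b : ℤ} (h : b < a) (ha : a ∉ T.1) :
    wsign ⟨insert a T.1, T.2.insert a⟩ b = -wsign T b := by
  have h0 : {s : ℤ | s ∈ insert a T.1 ∧ b < s} = insert a {s : ℤ | s ∈ T.1 ∧ b < s} := by
    ext s
    simp only [Set.mem_ofPred_eq, Set.mem_insert_iff]
    constructor
    · rintro ⟨rfl | hs, hb⟩
      · exact Or.inl rfl
      · exact Or.inr ⟨hs, hb⟩
    · rintro (rfl | ⟨hs, hb⟩)
      · exact ⟨Or.inl rfl, h⟩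
      · exact ⟨Or.inr hs, hb⟩
  unfold wsign
  rw [h0, Set.ncard_insert_of_notMem (fun h1 => ha h1.1) (finite_mem_above T b), pow_succ]
  ring

/-- For a < b, inserting b changes by one the number of elements above a, while inserting a leaves
the number above b unchanged; the two orders thus differ by one sign. -/
theorem ψs_anticomm (a b : ℤ) (v : Fock) (T : Maya) :
    ψs a (ψs b v) T = -ψs b (ψs a v) T := by
  wlog hab : a ≤ b generalizing a b
  · rw [this b a (by omega), neg_neg]
  by_cases ha : a ∈ T.1
  · rw [ψs_of_mem ha]
    by_cases hb : b ∈ T.1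
    · rw [ψs_of_mem hb, neg_zero]
    · rw [ψs_of_notMem hb, ψs_of_mem (Set.mem_insert_of_mem _ ha)]
      simp
  rw [ψs_of_notMem ha]
  by_cases hb : b ∈ T.1
  · rw [ψs_of_mem hb, ψs_of_mem (Set.mem_insert_of_mem _ hb)]
    simp
  rw [ψs_of_notMem hb]
  rcases hab.eq_or_lt with rfl | hlt
  · rw [ψs_of_mem (Set.mem_insert _ _)]
    simp
  have h1 : b ∉ insert a T.1 := by
    rintro (h | h)
    · omega
    · exact hb h
  have h2 : a ∉ insert b T.1 := by
    rintro (h | h)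
    · omega
    · exact ha h
  rw [ψs_of_notMem h1, ψs_of_notMem h2, wsign_insert_of_le hlt.le, wsign_insert_of_lt hlt hb]
  have h3 : (⟨insert b (insert a T.1), (T.2.insert a).insert b⟩ : Maya)
      = ⟨insert a (insert b T.1), (T.2.insert b).insert a⟩ :=
    Subtype.ext (Set.insert_comm b a T.1)
  rw [h3]
  ring

/-! ### Exterior multiplication by Laurent series -/

/-- The coefficient function of a Laurent series in `z⁻¹`. -/
def IsLaurent (f : ℤ → ℂ) : Prop := ∃ B : ℤ, ∀ n, B < n → f n = 0

theorem IsLaurent.zero : IsLaurent 0 := ⟨0, fun _ _ => rfl⟩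

theorem IsLaurent.add {f g : ℤ → ℂ} (hf : IsLaurent f) (hg : IsLaurent g) :
    IsLaurent (f + g) := by
  obtain ⟨A, hA⟩ := hf
  obtain ⟨B, hB⟩ := hg
  refine ⟨max A B, fun n hn => ?_⟩
  simp [hA n ((le_max_left _ _).trans_lt hn), hB n ((le_max_right _ _).trans_lt hn)]

theorem IsLaurent.smul {f : ℤ → ℂ} (c : ℂ) (hf : IsLaurent f) : IsLaurent (c • f) := by
  obtain ⟨A, hA⟩ := hf
  exact ⟨A, fun n hn => by simp [hA n hn]⟩

theorem support_wedge_subset {f : ℤ → ℂ} {B : ℤ} (hB : ∀ n, B < n → f n = 0) (v : Fock)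
    (T : Maya) : (Function.support fun n => f n * ψs n v T) ⊆ {s : ℤ | s ∉ T.1 ∧ s ≤ B} := by
  intro n hn
  rw [Function.mem_support] at hn
  refine ⟨fun h => hn ?_, not_lt.mp fun h => hn ?_⟩
  · rw [ψs_of_mem h, mul_zero]
  · rw [hB n h, zero_mul]

theorem wedge_eq_sum {f : ℤ → ℂ} {B : ℤ} (hB : ∀ n, B < n → f n = 0) (v : Fock) (T : Maya) :
    wedge f v T = ∑ n ∈ (finite_notMem_le T B).toFinset, f n * ψs n v T :=
  finsum_eq_sum_of_support_subset _ (by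
    rw [Set.Finite.coe_toFinset]
    exact support_wedge_subset hB v T)

theorem IsLaurent.finite_support_wedge {f : ℤ → ℂ} (hf : IsLaurent f) (v : Fock) (T : Maya) :
    (Function.support fun n => f n * ψs n v T).Finite := by
  obtain ⟨B, hB⟩ := hf
  exact (finite_notMem_le T B).subset (support_wedge_subset hB v T)

theorem wedge_zero_left (v : Fock) : wedge 0 v = 0 := by
  funext T
  simp [wedge]

theorem wedge_zero_right (f : ℤ → ℂ) : wedge f 0 = 0 := by
  funext T
  have h : ∀ n, ψs n 0 T = 0 := by
    intro n
    by_cases hn : n ∈ T.1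
    · exact ψs_of_mem hn _
    · simp [ψs_of_notMem hn]
  simp [wedge, h]

theorem wedge_add_left {f g : ℤ → ℂ} (hf : IsLaurent f) (hg : IsLaurent g) (v : Fock) :
    wedge (f + g) v = wedge f v + wedge g v := by
  funext T
  simp only [wedge, Pi.add_apply, add_mul]
  exact finsum_add_distrib (hf.finite_support_wedge v T) (hg.finite_support_wedge v T)

theorem wedge_smul_left (c : ℂ) (f : ℤ → ℂ) (v : Fock) : wedge (c • f) v = c • wedge f v := by
  funext T
  simp only [wedge, Pi.smul_apply, smul_eq_mul, mul_assoc]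
  exact (mul_finsum _ _).symm

theorem wedge_smul_right (c : ℂ) (f : ℤ → ℂ) (v : Fock) : wedge f (c • v) = c • wedge f v := by
  funext T
  simp only [wedge, Pi.smul_apply, smul_eq_mul]
  rw [mul_finsum]
  refine finsum_congr fun n => ?_
  by_cases hn : n ∈ T.1
  · simp [ψs_of_mem hn]
  · simp only [ψs_of_notMem hn, Pi.smul_apply, smul_eq_mul]
    ring

/-- The index set attached to T also serves for T with a inserted, so iterated wedges become double
sums over one finite rectangle and can be interchanged. -/
theorem ψs_wedge_eq_sum {f : ℤ → ℂ} {B : ℤ} (hB : ∀ n, B < n → f n = 0) (a : ℤ) (v : Fock)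
    (T : Maya) :
    ψs a (wedge f v) T
      = ∑ n ∈ (finite_notMem_le T B).toFinset, f n * ψs a (ψs n v) T := by
  by_cases ha : a ∈ T.1
  · simp [ψs_of_mem ha]
  rw [ψs_of_notMem ha, wedge, finsum_eq_sum_of_support_subset (s := (finite_notMem_le T B).toFinset),
    Finset.mul_sum]
  · refine Finset.sum_congr rfl fun n _ => ?_
    rw [ψs_of_notMem ha]
    ring
  · rw [Set.Finite.coe_toFinset]
    refine (support_wedge_subset hB v _).trans ?_
    rintro s ⟨hs, hs'⟩
    exact ⟨fun h => hs (Set.mem_insert_of_mem _ h), hs'⟩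

theorem wedge_anticomm {f g : ℤ → ℂ} (hf : IsLaurent f) (hg : IsLaurent g) (v : Fock) :
    wedge f (wedge g v) = -wedge g (wedge f v) := by
  obtain ⟨A, hA⟩ := hf
  obtain ⟨B, hB⟩ := hg
  funext T
  rw [Pi.neg_apply, wedge_eq_sum hA, wedge_eq_sum hB]
  simp_rw [ψs_wedge_eq_sum hA, ψs_wedge_eq_sum hB, Finset.mul_sum]
  rw [Finset.sum_comm, ← Finset.sum_neg_distrib]
  refine Finset.sum_congr rfl fun b _ => ?_
  rw [← Finset.sum_neg_distrib]
  refine Finset.sum_congr rfl fun a _ => ?_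
  rw [ψs_anticomm a b]
  ring

theorem wedge_self {f : ℤ → ℂ} (hf : IsLaurent f) (v : Fock) : wedge f (wedge f v) = 0 :=
  self_eq_neg.mp (wedge_anticomm hf hf v)

theorem wedge_wedgeFirst_of_wedge_eq_zero {φ : ℕ → ℤ → ℂ} (hφ : ∀ k, IsLaurent (φ k))
    {f : ℤ → ℂ} (hf : IsLaurent f) (N : ℕ) {v : Fock} (hv : wedge f v = 0) :
    wedge f (wedgeFirst φ N v) = 0 := by
  induction N generalizing v with
  | zero => exact hv
  | succ N ih =>
    refine ih ?_
    rw [wedge_anticomm hf (hφ N), hv, wedge_zero_right, neg_zero]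

/-- φ_i anticommutes past the other factors until it meets its own copy, where the square vanishes.
-/
theorem wedge_wedgeFirst {φ : ℕ → ℤ → ℂ} (hφ : ∀ k, IsLaurent (φ k)) {i N : ℕ} (hi : i < N)
    (v : Fock) : wedge (φ i) (wedgeFirst φ N v) = 0 := by
  induction N generalizing v with
  | zero => omega
  | succ N ih =>
    rcases (Nat.lt_succ_iff.mp hi).eq_or_lt with rfl | h
    · exact wedge_wedgeFirst_of_wedge_eq_zero hφ (hφ i) i (wedge_self (hφ i) v)
    · exact ih h _

/-! ### The vacuum coefficient of a semi-infinite wedge product -/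

/-- Without a z^a term, f never inserts a, so coefficients at sets avoiding a depend only on
coefficients at sets avoiding a. -/
theorem wedge_congr_off {f : ℤ → ℂ} {a : ℤ} (hf : f a = 0) {v w : Fock}
    (h : ∀ S : Maya, a ∉ S.1 → v S = w S) (S : Maya) (hS : a ∉ S.1) :
    wedge f v S = wedge f w S := by
  refine finsum_congr fun n => ?_
  by_cases hn : n ∈ S.1
  · rw [ψs_of_mem hn, ψs_of_mem hn]
  rcases eq_or_ne a n with rfl | ha
  · simp [hf]
  rw [ψs_of_notMem hn, ψs_of_notMem hn, h]
  rintro (h1 | h1)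
  · exact ha h1
  · exact hS h1

theorem wedgeFirst_congr_off {φ : ℕ → ℤ → ℂ} {a : ℤ} (N : ℕ) (hφ : ∀ k < N, φ k a = 0)
    {v w : Fock} (h : ∀ S : Maya, a ∉ S.1 → v S = w S) (S : Maya) (hS : a ∉ S.1) :
    wedgeFirst φ N v S = wedgeFirst φ N w S := by
  induction N generalizing v w with
  | zero => exact h S hS
  | succ N ih =>
    exact ih (fun k hk => hφ k (hk.trans (Nat.lt_succ_self N)))
      (wedge_congr_off (hφ N (Nat.lt_succ_self N)) h)

theorem vac_apply_self (n : ℤ) (h : IsAdmissible (Set.Iio n)) : vac n ⟨Set.Iio n, h⟩ = 1 := by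
  unfold vac ket
  exact if_pos rfl

theorem vac_apply_of_ne {n : ℤ} {T : Maya} (h : T.1 ≠ Set.Iio n) : vac n T = 0 := by
  unfold vac ket
  exact if_neg fun h1 => h (congrArg Subtype.val h1)

theorem insert_self_Iio (n : ℤ) : insert n (Set.Iio n) = Set.Iio (n + 1) := by
  ext s
  simp only [Set.mem_insert_iff, Set.mem_Iio]
  omega

/-- The vacuum contains a, so reaching a set without a forces the z^a term of f to act. -/
theorem wedge_vac_succ {f : ℤ → ℂ} {a : ℤ} (hf : f a = 1) (S : Maya) (hS : a ∉ S.1) :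
    wedge f (vac (a + 1)) S = vac a S := by
  rw [wedge, finsum_eq_single _ a, hf, one_mul, ψs_of_notMem hS]
  · by_cases h : S.1 = Set.Iio a
    · obtain ⟨S, hS'⟩ := S
      obtain rfl : S = Set.Iio a := h
      rw [vac_apply_self, wsign_eq_one fun s hs => le_of_lt hs, one_mul]
      simp only [insert_self_Iio]
      exact vac_apply_self _ _
    · rw [vac_apply_of_ne h, vac_apply_of_ne, mul_zero]
      intro h1
      refine h ?_
      rw [← insert_self_Iio] at h1
      have h2 := congrArg (· \ {a}) h1
      simpa [Set.insert_sdiff_of_mem, Set.sdiff_singleton_eq_self hS] using h2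
  · intro n hn
    by_cases hn' : n ∈ S.1
    · rw [ψs_of_mem hn', mul_zero]
    rw [ψs_of_notMem hn', vac_apply_of_ne]
    · simp
    intro h1
    have h2 : a ∈ insert n S.1 := h1.superset (Int.lt_succ a)
    rcases h2 with h2 | h2
    · exact hn h2.symm
    · exact hS h2

/-- Triangularity: the factors φ_k with k < N have no z^N term and N lies outside the vacuum set, so
φ_N ∧ |N+1⟩ may be replaced by |N⟩. -/
theorem vev_truncWedge {φ : ℕ → ℤ → ℂ} (h1 : ∀ k : ℕ, φ k k = 1)
    (h2 : ∀ (k : ℕ) (n : ℤ), (k : ℤ) < n → φ k n = 0) (N : ℕ) : vev (truncWedge φ N) = 1 := by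
  induction N with
  | zero => exact vac_apply_self 0 _
  | succ N ih =>
    rw [← ih]
    refine wedgeFirst_congr_off (a := (N : ℤ)) N (fun k hk => h2 k N (by omega)) ?_ _ ?_
    · intro S hS
      push_cast
      exact wedge_vac_succ (h1 N) S hS
    · simp

theorem IsAdmissibleBasis.isLaurent {φ : ℕ → ℤ → ℂ} {V : Fock} (h : IsAdmissibleBasis φ V)
    (k : ℕ) : IsLaurent (φ k) := ⟨k, h.above k⟩

theorem IsAdmissibleBasis.vev_ne_zero {φ : ℕ → ℤ → ℂ} {V : Fock} (h : IsAdmissibleBasis φ V) :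
    vev V ≠ 0 := by
  obtain ⟨c, w, hc, hw, rfl⟩ := h.wedge_eq
  obtain ⟨N, hN⟩ := (hw ⟨Set.Iio 0, isAdmissible_Iio 0⟩).exists
  have h1 : vev w = 1 := by
    rw [← vev_truncWedge h.leading h.above N]
    exact hN.symm
  have h2 : vev (c • w) = c * vev w := rfl
  rw [h2, h1, mul_one]
  exact hc

theorem IsAdmissibleBasis.wedge_eq_zero {φ : ℕ → ℤ → ℂ} {V : Fock} (h : IsAdmissibleBasis φ V)
    (k : ℕ) : wedge (φ k) V = 0 := by
  obtain ⟨c, w, hc, hw, rfl⟩ := h.wedge_eq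
  rw [wedge_smul_right]
  suffices hs : wedge (φ k) w = 0 by rw [hs, smul_zero]
  funext T
  -- A single coefficient of φ_k ∧ w reads only finitely many coefficients of w, so one truncation
  -- with N > k, which φ_k kills, already computes it.
  have hev : ∀ᶠ N : ℕ in atTop, ∀ n ∈ (finite_notMem_le T k).toFinset,
      truncWedge φ N ⟨insert n T.1, T.2.insert n⟩ = w ⟨insert n T.1, T.2.insert n⟩ :=
    (Finset.eventually_all _).mpr fun n _ => hw _
  obtain ⟨N, hN, hkN⟩ := (hev.and (eventually_gt_atTop k)).exists
  have h0 : wedge (φ k) (truncWedge φ N) T = 0 :=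
    congrFun (wedge_wedgeFirst h.isLaurent hkN (vac N)) T
  rw [Pi.zero_apply, ← h0, wedge_eq_sum (h.above k), wedge_eq_sum (h.above k)]
  refine Finset.sum_congr rfl fun n hn => ?_
  have hn' : n ∉ T.1 := ((Set.Finite.mem_toFinset _).mp hn).1
  rw [ψs_of_notMem hn', ψs_of_notMem hn', hN n hn]

/-! ### The two-point function through the coefficients of the tau-function -/

theorem twoPoint_of_nonneg (V : Fock) {m : ℤ} (hm : 0 ≤ m) (n : ℤ) : twoPoint V m n = 0 := by
  have h : -m - 1 ∈ Set.Iio (0 : ℤ) := by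
    simp only [Set.mem_Iio]
    omega
  rw [twoPoint, vev, ψs_of_mem h, zero_div]

theorem vev_ψs {j : ℤ} (hj : 0 ≤ j) (v : Fock) :
    vev (ψs j v) = v ⟨insert j (Set.Iio 0), (isAdmissible_Iio 0).insert j⟩ := by
  rw [vev, ψs_of_notMem (by simpa using hj), wsign_eq_one, one_mul]
  intro s hs
  exact (le_of_lt hs).trans hj

/-- This is the part 1/(u-v) = ∑_j u^{-j-1} v^j of the two-point function, expanded in |u| > |v|. -/
theorem twoPoint_of_nonneg_right {V : Fock} (hV : vev V ≠ 0) {j n : ℤ} (hj : 0 ≤ j)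
    (hn : 0 ≤ n) : twoPoint V (-j - 1) n = if n = j then 1 else 0 := by
  rw [twoPoint, show -(-j - 1) - 1 = j by ring, vev_ψs hj]
  split_ifs with h
  · subst h
    rw [ψ_of_mem (Set.mem_insert _ _),
      wsign_insert_of_le (T := ⟨Set.Iio 0, isAdmissible_Iio 0⟩) le_rfl, wsign_eq_one, one_mul]
    · have h1 : (⟨insert n (Set.Iio 0) \ {n}, ((isAdmissible_Iio 0).insert n).erase n⟩ : Maya)
          = ⟨Set.Iio 0, isAdmissible_Iio 0⟩ := by
        refine Subtype.ext ?_
        simp [Set.insert_sdiff_of_mem, Set.sdiff_singleton_eq_self, hn]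
      rw [h1]
      exact div_self hV
    · intro s hs
      exact (le_of_lt hs).trans hn
  · rw [ψ_of_notMem, zero_div]
    rintro (h1 | h1)
    · exact h h1
    · exact absurd h1 (not_lt.mpr hn)

theorem insert_sdiff_comm {j n : ℤ} (h : j ≠ n) (S : Set ℤ) :
    insert j S \ {n} = insert j (S \ {n}) := by
  rw [Set.insert_sdiff_of_notMem]
  simpa using h

theorem twoPoint_of_neg_right (V : Fock) {j n : ℤ} (hj : 0 ≤ j) (hn : n < 0) :
    twoPoint V (-j - 1) n = -wsign ⟨Set.Iio 0, isAdmissible_Iio 0⟩ n *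
      V ⟨insert j (Set.Iio 0 \ {n}), ((isAdmissible_Iio 0).erase n).insert j⟩ / vev V := by
  rw [twoPoint, show -(-j - 1) - 1 = j by ring, vev_ψs hj,
    ψ_of_mem (Set.mem_insert_of_mem j (Set.mem_Iio.mpr hn)),
    wsign_insert_of_lt (T := ⟨Set.Iio 0, isAdmissible_Iio 0⟩) (hn.trans_le hj) (by simpa using hj)]
  have h1 : (⟨insert j (Set.Iio 0) \ {n}, ((isAdmissible_Iio 0).insert j).erase n⟩ : Maya)
      = ⟨insert j (Set.Iio 0 \ {n}), ((isAdmissible_Iio 0).erase n).insert j⟩ :=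
    Subtype.ext (insert_sdiff_comm (by omega) _)
  rw [h1]

/-- A Laurent series `f` with `f ∧ V = 0` is determined by its coefficients at nonnegative powers,
and the rows of the two-point function are the basis dual to these coefficients. -/
theorem eq_finsum_twoPoint {V : Fock} (hV : vev V ≠ 0) {f : ℤ → ℂ} (hf : IsLaurent f)
    (hfV : wedge f V = 0) (n : ℤ) : f n = ∑ᶠ j : ℤ, f j * twoPoint V (-j - 1) n := by
  have hneg : ∀ j < 0, twoPoint V (-j - 1) n = 0 := fun j hj =>
    twoPoint_of_nonneg V (by omega) n
  rcases lt_or_ge n 0 with hn | hn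
  · have hS := (isAdmissible_Iio 0).erase n
    have hins : (⟨insert n (Set.Iio 0 \ {n}), hS.insert n⟩ : Maya)
        = ⟨Set.Iio 0, isAdmissible_Iio 0⟩ :=
      Subtype.ext (Set.insert_sdiff_self_of_mem hn)
    have hsgn : wsign ⟨Set.Iio 0 \ {n}, hS⟩ n = wsign ⟨Set.Iio 0, isAdmissible_Iio 0⟩ n := by
      rw [← hins]
      exact (wsign_insert_of_le (T := ⟨Set.Iio 0 \ {n}, hS⟩) le_rfl).symm
    set σ := wsign ⟨Set.Iio 0, isAdmissible_Iio 0⟩ n with hσ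
    have hσ0 : σ ≠ 0 := wsign_ne_zero _ _
    have hσ2 : σ * σ = 1 := by
      rw [hσ, wsign, ← mul_pow]
      norm_num
    have h0 : wedge f V ⟨Set.Iio 0 \ {n}, hS⟩ = 0 := congrFun hfV _
    -- In the equation f ∧ V = 0 at the vacuum with n removed, only n and the j ≥ 0 are free: j = n
    -- gives f_n times `vev V`, and j ≥ 0 gives the coefficient of V entering the row E_j.
    have hterm : ∀ j, f j * ψs j V ⟨Set.Iio 0 \ {n}, hS⟩
        = (if j = n then f n * σ * vev V else 0)
          + -(σ * vev V) * (f j * twoPoint V (-j - 1) n) := by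
      intro j
      split_ifs with hj
      · subst hj
        rw [hneg j hn, ψs_of_notMem (by simp), hsgn, hins]
        simp only [vev]
        ring
      rcases lt_or_ge j 0 with hj0 | hj0
      · rw [hneg j hj0, ψs_of_mem (T := ⟨Set.Iio 0 \ {n}, hS⟩) ⟨hj0, hj⟩]
        ring
      · rw [twoPoint_of_neg_right V hj0 hn, ψs_of_notMem
            (T := ⟨Set.Iio 0 \ {n}, hS⟩) (fun h => absurd h.1 (not_lt.mpr hj0)),
          wsign_eq_one (T := ⟨Set.Iio 0 \ {n}, hS⟩) (fun s hs => (le_of_lt hs.1).trans hj0), ← hσ]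
        field_simp
        linear_combination -(f j * V ⟨insert j (Set.Iio 0 \ {n}), hS.insert j⟩) * hσ2
    have hfin : (Function.support fun j => f j * twoPoint V (-j - 1) n).Finite := by
      obtain ⟨B, hB⟩ := hf
      refine (Set.finite_Icc 0 B).subset fun j hj => ?_
      rw [Function.mem_support] at hj
      refine ⟨not_lt.mp fun h => hj ?_, not_lt.mp fun h => hj ?_⟩
      · rw [hneg j h, mul_zero]
      · rw [hB j h, zero_mul]
    rw [wedge, finsum_congr hterm, finsum_add_distrib, ← mul_finsum,
      finsum_eq_single _ n (fun j hj => if_neg hj), if_pos rfl] at h0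
    · have h1 : σ * vev V ≠ 0 := mul_ne_zero hσ0 hV
      refine mul_left_cancel₀ h1 ?_
      linear_combination h0
    · refine (Set.finite_singleton n).subset fun j hj => ?_
      by_contra h
      exact hj (if_neg h)
    · refine hfin.subset fun j hj => ?_
      rw [Function.mem_support] at hj ⊢
      exact fun h => hj (by rw [h, mul_zero])
  · rw [finsum_eq_single _ n, twoPoint_of_nonneg_right hV hn hn, if_pos rfl, mul_one]
    intro j hj
    rcases lt_or_ge j 0 with hj0 | hj0
    · rw [hneg j hj0, mul_zero]
    · rw [twoPoint_of_nonneg_right hV hj0 hn, if_neg hj.symm, mul_zero]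

theorem dualOnePoint_of_pos (V : Fock) {m : ℤ} (hm : 0 < m) : dualOnePoint V m = 0 := by
  rw [dualOnePoint, vev, ψ_of_mem (by simp), ψs_of_mem]
  · simp
  · simp only [Set.mem_sdiff, Set.mem_Iio, Set.mem_singleton_iff]
    omega

theorem vev_ψ_neg_one (v : Fock) :
    vev (ψ (-1) v) = v ⟨Set.Iio 0 \ {-1}, (isAdmissible_Iio 0).erase (-1)⟩ := by
  rw [vev, ψ_of_mem (by simp), wsign_eq_one, one_mul]
  intro s hs
  have : s < 0 := hs
  omega

theorem dualOnePoint_zero {V : Fock} (hV : vev V ≠ 0) : dualOnePoint V 0 = 1 := by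
  rw [dualOnePoint, vev_ψ_neg_one, show (-0 - 1 : ℤ) = -1 by ring, ψs_of_notMem (by simp),
    wsign_eq_one, one_mul]
  · have h1 : (⟨insert (-1) (Set.Iio 0 \ {-1}), ((isAdmissible_Iio 0).erase (-1)).insert (-1)⟩ :
        Maya) = ⟨Set.Iio 0, isAdmissible_Iio 0⟩ :=
      Subtype.ext (Set.insert_sdiff_self_of_mem (by simp))
    rw [h1]
    exact div_self hV
  · intro s hs
    have : s < 0 := hs.1
    omega

/-- Both sides read the coefficient of V with j filled and -1 vacated; in the two-point function the
fermion at -1 also passes j, whence the sign. -/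
theorem dualOnePoint_of_neg (V : Fock) {j : ℤ} (hj : 0 ≤ j) :
    dualOnePoint V (-j - 1) = -twoPoint V (-j - 1) (-1) := by
  rw [twoPoint_of_neg_right V hj (by norm_num), dualOnePoint, vev_ψ_neg_one,
    show -(-j - 1) - 1 = j by ring, ψs_of_notMem
      (T := ⟨Set.Iio 0 \ {-1}, (isAdmissible_Iio 0).erase (-1)⟩)
      (fun h => absurd h.1 (not_lt.mpr hj)),
    wsign_eq_one (T := ⟨Set.Iio 0 \ {-1}, (isAdmissible_Iio 0).erase (-1)⟩)
      (fun s hs => (le_of_lt hs.1).trans hj), wsign_eq_one]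
  · ring
  · intro s hs
    have : s < 0 := hs
    omega

theorem onePoint_eq_twoPoint (V : Fock) (n : ℤ) : onePoint V n = twoPoint V (-1) n := rfl

theorem isLaurent_twoPoint {V : Fock} (hV : vev V ≠ 0) (m : ℤ) : IsLaurent (twoPoint V m) := by
  rcases lt_or_ge m 0 with hm | hm
  · refine ⟨max 0 (-m - 1), fun n hn => ?_⟩
    have h1 := (le_max_left _ _).trans_lt hn
    have h2 := (le_max_right _ _).trans_lt hn
    have h3 := twoPoint_of_nonneg_right hV (show 0 ≤ -m - 1 by omega) h1.le
    rw [show -(-m - 1) - 1 = m by ring, if_neg h2.ne'] at h3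
    exact h3
  · exact ⟨0, fun n _ => twoPoint_of_nonneg V hm n⟩

/-! ### Action of the operators on Laurent series -/

theorem W.finite_support_act (l : W) {f : ℤ → ℂ} (hf : IsLaurent f) (m : ℤ) :
    (Function.support fun n => l.symbol (m - n) m * f n).Finite := by
  obtain ⟨B, hB⟩ := hf
  obtain ⟨D, hD⟩ := l.bounded
  refine (Set.finite_Icc (m - D) B).subset fun n hn => ?_
  rw [Function.mem_support] at hn
  refine ⟨not_lt.mp fun h => hn ?_, not_lt.mp fun h => hn ?_⟩
  · rw [hD (m - n) (by omega)]
    simp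
  · rw [hB n h, mul_zero]

theorem W.act_zero (l : W) : l.act 0 = 0 := by
  funext m
  simp [W.act]

theorem W.act_add (l : W) {f g : ℤ → ℂ} (hf : IsLaurent f) (hg : IsLaurent g) :
    l.act (f + g) = l.act f + l.act g := by
  funext m
  simp only [W.act, Pi.add_apply, mul_add]
  exact finsum_add_distrib (l.finite_support_act hf m) (l.finite_support_act hg m)

theorem W.act_smul (l : W) (c : ℂ) (f : ℤ → ℂ) : l.act (c • f) = c • l.act f := by
  funext m
  simp only [W.act, Pi.smul_apply, smul_eq_mul]
  rw [mul_finsum]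
  exact finsum_congr fun n => by ring

theorem W.exists_act_eq_smul {l : W} {φ : ℕ → ℤ → ℂ} {a : ℕ → ℂ}
    (h : ∀ k : ℕ, 1 ≤ k → a k ≠ 0 ∧ l.act^[k] (φ 0) = a k • φ k) (k : ℕ) :
    ∃ b : ℂ, l.act (φ k) = b • φ (k + 1) := by
  -- The case k = 0 is separate because `a 0` is unconstrained.
  rcases Nat.eq_zero_or_pos k with rfl | hk
  · exact ⟨a 1, (h 1 le_rfl).2⟩
  · obtain ⟨h1, h2⟩ := h k hk
    have h3 := (h (k + 1) (by omega)).2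
    rw [Function.iterate_succ_apply', h2, W.act_smul] at h3
    refine ⟨(a k)⁻¹ * a (k + 1), ?_⟩
    rw [mul_smul, ← h3, smul_smul, inv_mul_cancel₀ h1, one_smul]

/-- The coefficient of z^{k+D} in l φ_k is p_D(k+D), and it vanishes because k+D > k+1. Infinitely
many roots kill a polynomial; an entire function such as sin(πx) would survive. -/
theorem W.symbol_eq_zero_of_top {l : W} {φ : ℕ → ℤ → ℂ} (h1 : ∀ k : ℕ, φ k k = 1)
    (h2 : ∀ (k : ℕ) (n : ℤ), (k : ℤ) < n → φ k n = 0)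
    (h : ∀ k, ∃ b : ℂ, l.act (φ k) = b • φ (k + 1)) {D : ℤ} (hD : 2 ≤ D)
    (htop : ∀ d, D < d → l.symbol d = 0) : l.symbol D = 0 := by
  have hroot : ∀ k : ℕ, l.symbol D ((k : ℂ) + D) = 0 := by
    intro k
    obtain ⟨b, hb⟩ := h k
    have h3 := congrFun hb (k + D)
    rw [Pi.smul_apply, h2 (k + 1) _ (by push_cast; omega), smul_zero, W.act,
      finsum_eq_single _ (k : ℤ), h1, mul_one] at h3
    · simpa using h3
    · intro n hn
      rcases lt_or_gt_of_ne hn with hlt | hlt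
      · rw [htop _ (by omega)]
        simp
      · rw [h2 k n hlt, mul_zero]
  obtain ⟨P, hP⟩ := l.polynomial D hD
  have hP0 : P = 0 := by
    refine Polynomial.eq_zero_of_infinite_isRoot P ?_
    refine (Set.infinite_range_of_injective (f := fun k : ℕ => (k : ℂ) + D) ?_).mono ?_
    · intro i j hij
      simpa using hij
    · rintro _ ⟨k, rfl⟩
      exact (hP _).symm.trans (hroot k)
  funext x
  rw [hP, hP0]
  simp

theorem W.symbol_eq_zero {l : W} {φ : ℕ → ℤ → ℂ} (h1 : ∀ k : ℕ, φ k k = 1)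
    (h2 : ∀ (k : ℕ) (n : ℤ), (k : ℤ) < n → φ k n = 0)
    (h : ∀ k, ∃ b : ℂ, l.act (φ k) = b • φ (k + 1)) {d : ℤ} (hd : 1 < d) : l.symbol d = 0 := by
  obtain ⟨D, hD⟩ := l.bounded
  -- Descending induction on the degree: once everything above d is known to vanish, p_d is the top
  -- symbol.
  have key : ∀ i : ℕ, ∀ d : ℤ, 1 < d → D - i < d → l.symbol d = 0 := by
    intro i
    induction i with
    | zero =>
      intro d _ hd
      exact hD d (by simpa using hd)
    | succ i ih =>
      intro d hd1 hd2
      push_cast at hd2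
      exact W.symbol_eq_zero_of_top h1 h2 h hd1 fun e he => ih e (by omega) (by omega)
  exact key (D - 1).toNat d hd (by omega)

/-! ### The point of the Grassmannian -/

theorem IsAdmissibleBasis.of_mem_span {φ : ℕ → ℤ → ℂ} {V : Fock} (h : IsAdmissibleBasis φ V)
    {f : ℤ → ℂ} (hf : f ∈ Submodule.span ℂ (Set.range φ)) : IsLaurent f ∧ wedge f V = 0 := by
  induction hf using Submodule.span_induction with
  | mem f hf =>
    obtain ⟨k, rfl⟩ := hf
    exact ⟨h.isLaurent k, h.wedge_eq_zero k⟩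
  | zero => exact ⟨IsLaurent.zero, wedge_zero_left V⟩
  | add f g _ _ hf hg =>
    exact ⟨hf.1.add hg.1, by rw [wedge_add_left hf.1 hg.1, hf.2, hg.2, add_zero]⟩
  | smul c f _ hf => exact ⟨hf.1.smul c, by rw [wedge_smul_left, hf.2, smul_zero]⟩

theorem IsAdmissibleBasis.act_mem_span {φ : ℕ → ℤ → ℂ} {V : Fock} (h : IsAdmissibleBasis φ V)
    {l : W} (hl : ∀ k, ∃ b : ℂ, l.act (φ k) = b • φ (k + 1)) {f : ℤ → ℂ}
    (hf : f ∈ Submodule.span ℂ (Set.range φ)) : l.act f ∈ Submodule.span ℂ (Set.range φ) := by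
  induction hf using Submodule.span_induction with
  | mem f hf =>
    obtain ⟨k, rfl⟩ := hf
    obtain ⟨b, hb⟩ := hl k
    rw [hb]
    exact Submodule.smul_mem _ _ (Submodule.subset_span ⟨k + 1, rfl⟩)
  | zero =>
    rw [W.act_zero]
    exact Submodule.zero_mem _
  | add f g hf hg hf' hg' =>
    rw [W.act_add l (h.of_mem_span hf).1 (h.of_mem_span hg).1]
    exact Submodule.add_mem _ hf' hg'
  | smul c f _ hf =>
    rw [W.act_smul]
    exact Submodule.smul_mem _ _ hf

theorem IsAdmissibleBasis.eq_sum_twoPoint {φ : ℕ → ℤ → ℂ} {V : Fock}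
    (h : IsAdmissibleBasis φ V) (k : ℕ) :
    φ k = twoPoint V (-(k : ℤ) - 1)
      + ∑ j ∈ Finset.range k, φ k j • twoPoint V (-(j : ℤ) - 1) := by
  funext n
  have hsub : (Function.support fun j : ℤ => φ k j * twoPoint V (-j - 1) n) ⊆
      ((Finset.range (k + 1)).map Nat.castEmbedding : Finset ℤ) := by
    intro j hj
    rw [Function.mem_support] at hj
    have h1 : 0 ≤ j := not_lt.mp fun h1 =>
      hj (by rw [twoPoint_of_nonneg V (by omega), mul_zero])
    have h2 : j ≤ k := not_lt.mp fun h2 => hj (by rw [h.above k j h2, zero_mul])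
    simp only [Finset.coe_map, Set.mem_image, Finset.mem_coe, Finset.mem_range]
    exact ⟨j.toNat, by omega, by simp [h1]⟩
  rw [eq_finsum_twoPoint h.vev_ne_zero (h.isLaurent k) (h.wedge_eq_zero k) n,
    finsum_eq_sum_of_support_subset _ hsub, Finset.sum_map, Finset.sum_range_succ]
  simp [h.leading, add_comm]

/-- Inverts the unitriangular relation `eq_sum_twoPoint`. Finite combinations suffice, so l can be
applied to E_j by linearity alone. -/
theorem IsAdmissibleBasis.twoPoint_mem_span {φ : ℕ → ℤ → ℂ} {V : Fock}
    (h : IsAdmissibleBasis φ V) (k : ℕ) :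
    twoPoint V (-(k : ℤ) - 1) ∈ Submodule.span ℂ (Set.range φ) := by
  induction k using Nat.strong_induction_on with
  | _ k ih =>
    rw [← add_sub_cancel_right (twoPoint V (-(k : ℤ) - 1))
      (∑ j ∈ Finset.range k, φ k j • twoPoint V (-(j : ℤ) - 1)), ← h.eq_sum_twoPoint k]
    exact Submodule.sub_mem _ (Submodule.subset_span ⟨k, rfl⟩)
      (Submodule.sum_mem _ fun j hj => Submodule.smul_mem _ _ (ih j (Finset.mem_range.mp hj)))

/-! ### The action on the two-point function -/

theorem W.adjoint_actU_twoPoint (l : W) (V : Fock) (j n : ℤ) :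
    l.adjoint.actU (twoPoint V) (-j - 1) n
      = ∑ᶠ k : ℤ, l.symbol (k - j) k * twoPoint V (-k - 1) n := by
  unfold W.actU W.act W.adjoint
  -- Under i = -k-1 the degree is d = k-j, and the adjoint's argument d-1-x at x = -j-1 is exactly
  -- k.
  refine finsum_eq_of_bijective (fun i : ℤ => -i - 1) ?_ fun i => ?_
  · refine Function.Involutive.bijective fun i => ?_
    ring
  · simp only
    rw [show -(-i - 1) - 1 = i by ring, show -i - 1 - j = -j - 1 - i by ring]
    congr 2
    push_cast
    ring

theorem W.finite_support_symbol_mul_twoPoint (l : W) (V : Fock) (j n : ℤ) :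
    (Function.support fun k : ℤ => l.symbol (k - j) k * twoPoint V (-k - 1) n).Finite := by
  obtain ⟨D, hD⟩ := l.bounded
  refine (Set.finite_Icc 0 (j + D)).subset fun k hk => ?_
  rw [Function.mem_support] at hk
  refine ⟨not_lt.mp fun h => hk ?_, not_lt.mp fun h => hk ?_⟩
  · rw [twoPoint_of_nonneg V (by omega), mul_zero]
  · rw [hD _ (by omega)]
    simp

/-- The only nonnegative power in E_j is z^j. A term z^i with i < 0 reaches z^k with k ≥ 0 in degree
k-i ≤ 1 only when i = -1 and k = 0. -/
theorem W.act_twoPoint_coeff {l : W} (hl : ∀ d, 1 < d → l.symbol d = 0) {V : Fock}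
    (hV : vev V ≠ 0) {j k : ℤ} (hj : 0 ≤ j) (hk : 0 ≤ k) :
    l.act (twoPoint V (-j - 1)) k
      = l.symbol (k - j) k
        + if k = 0 then l.symbol 1 0 * twoPoint V (-j - 1) (-1) else 0 := by
  have hterm : ∀ i, l.symbol (k - i) k * twoPoint V (-j - 1) i
      = (if i = j then l.symbol (k - j) k else 0)
        + if i = -1 then (if k = 0 then l.symbol 1 0 * twoPoint V (-j - 1) (-1) else 0) else 0 := by
    intro i
    rcases lt_or_ge i 0 with hi | hi
    · rw [if_neg (by omega), zero_add]
      split_ifs with h1 h2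
      · subst h1 h2
        simp
      · rw [hl _ (by omega)]
        simp
      · rw [hl _ (by omega)]
        simp
    · rw [twoPoint_of_nonneg_right hV hj hi, if_neg (show i ≠ -1 by omega), add_zero]
      split_ifs with h1
      · rw [h1, mul_one]
      · rw [mul_zero]
  rw [W.act, finsum_congr hterm, finsum_add_distrib,
    finsum_eq_single _ j (fun i hi => if_neg hi), if_pos rfl,
    finsum_eq_single _ (-1) (fun i hi => if_neg hi), if_pos rfl]
  · refine (Set.finite_singleton j).subset fun i hi => ?_
    by_contra h
    exact hi (if_neg h)
  · refine (Set.finite_singleton (-1 : ℤ)).subset fun i hi => ?_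
    by_contra h
    exact hi (if_neg h)

end KP

/-! ### The identity, row by row in u. -/

theorem theorem4p4 (V : KP.Fock) (hV : KP.IsBigCellTau V) (l : KP.W)
    (hl : KP.IsLiftingOperator l V) :
    ∀ m n : ℤ,
      l.adjoint.actU (KP.twoPoint V) m n - l.actV (KP.twoPoint V) m n =
        KP.dualOnePoint V m * KP.onePoint V n := by
  obtain ⟨⟨φ, a, hφ, ha⟩, hl1⟩ := hl
  have hact := KP.W.exists_act_eq_smul ha
  have hdeg : ∀ d, 1 < d → l.symbol d = 0 := fun d hd =>
    KP.W.symbol_eq_zero hφ.leading hφ.above hact hd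
  have hV0 := hφ.vev_ne_zero
  intro m n
  obtain ⟨j, rfl⟩ : ∃ j : ℤ, m = -j - 1 := ⟨-m - 1, by ring⟩
  rw [KP.W.adjoint_actU_twoPoint, KP.W.actV, KP.onePoint_eq_twoPoint]
  change _ - l.act (KP.twoPoint V (-j - 1)) n = _
  rcases lt_or_ge j 0 with hj | hj
  -- Nonnegative powers of u: the row of Ψ(u,v) is zero, and a degree-one operator can bring only
  -- the row E_0 up to u^0.
  · have h0 : KP.twoPoint V (-j - 1) = 0 := by
      funext i
      exact KP.twoPoint_of_nonneg V (by omega) i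
    rw [h0, KP.W.act_zero, Pi.zero_apply, sub_zero, finsum_eq_single _ (0 : ℤ)]
    · rcases eq_or_ne j (-1) with rfl | hj1
      · rw [show (-(-1) - 1 : ℤ) = 0 by ring, KP.dualOnePoint_zero hV0]
        simp [hl1]
      · rw [hdeg _ (by omega), KP.dualOnePoint_of_pos V (by omega)]
        simp
    · intro k hk
      rcases lt_or_ge k 0 with hk0 | hk0
      · rw [KP.twoPoint_of_nonneg V (by omega), mul_zero]
      · rw [hdeg _ (by omega)]
        simp
  · have hmem : l.act (KP.twoPoint V (-j - 1)) ∈ Submodule.span ℂ (Set.range φ) := by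
      have h1 := hφ.act_mem_span hact (hφ.twoPoint_mem_span j.toNat)
      rwa [Int.toNat_of_nonneg hj] at h1
    obtain ⟨hL, hw⟩ := hφ.of_mem_span hmem
    have hterm : ∀ k : ℤ, l.act (KP.twoPoint V (-j - 1)) k * KP.twoPoint V (-k - 1) n
        = l.symbol (k - j) k * KP.twoPoint V (-k - 1) n
          + if k = 0 then KP.twoPoint V (-j - 1) (-1) * KP.twoPoint V (-1) n else 0 := by
      intro k
      rcases lt_or_ge k 0 with hk | hk
      · rw [KP.twoPoint_of_nonneg V (by omega), if_neg (by omega)]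
        ring
      · rw [KP.W.act_twoPoint_coeff hdeg hV0 hj hk, hl1]
        split_ifs with h1
        · subst h1
          simp only [neg_zero, zero_sub]
          ring
        · ring
    -- Expanding l E_j in the rows E_k reproduces the adjoint sum, plus the single defect E_j(-1)
    -- E_0 at k = 0.
    rw [KP.eq_finsum_twoPoint hV0 hL hw n, finsum_congr hterm,
      finsum_add_distrib (l.finite_support_symbol_mul_twoPoint V j n),
      finsum_eq_single _ (0 : ℤ) (fun i hi => if_neg hi), if_pos rfl,
      KP.dualOnePoint_of_neg V hj]
    · ring
    · refine (Set.finite_singleton (0 : ℤ)).subset fun i hi => ?_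
      by_contra h
      exact hi (if_neg h)
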